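/- Let $\mathbb D$ be the open unit disk and let $H$ be a Hilbert space of analytic functions on $\mathbb D$ with bounded point evaluations, whose reproducing kernel has the form $$K_w(z)=\sum_{n=0}^\infty \gamma(n)(\overline{w}z)^n,\qquad z,w\in\mathbb D,$$ with $\gamma(n)>0$ for all $n$ and $\gamma(0)=1$. Let $F$ be analytic in $\mathbb D$, let $\varphi$ be an analytic map of $\mathbb D$ into itself, and suppose that the weighted composition operator $W_{F,\varphi}f=F\cdot(f\circ\varphi)$ is a bounded operator on $H$. Then $W_{F,\varphi}$ is unitary if and only if it is co-isometric, that is, $W_{F,\varphi}W_{F,\varphi}^*=I$. For $g>0$, say that $H=\mathcal H_g$ if $K_w(z)=(1-\overline{w}z)^{-g}$ (principal branch) for all $z,w\in\mathbb D$. (a) If $H=\mathcal H_g$ for some $g>0$, then $W_{F,\varphi}$ is co-isometric if and only if $\varphi$ is a disk automorphism (an analytic bijection of $\mathbb D$ onto itself) and $$F=\mu(\varphi')^{g/2}=\nu\frac{K_a}{\|K_a\|},\qquad a=\varphi^{-1}(0),$$ for some constants $\mu,\nu$ with $|\mu|=|\nu|=1$, where $(\varphi')^{g/2}$ denotes an analytic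 branch of the power on $\mathbb D$. Moreover, when $\varphi$ is a disk automorphism, $F=\mu(\varphi')^{g/2}$ for some $\mu$ with $|\mu|=1$ if and only if $F=\nu K_a/\|K_a\|$ for some $\nu$ with $|\nu|=1$, so that either formula alone suffices. (b) If $H$ is not one of the spaces $\mathcal H_g$, $g>0$, then $W_{F,\varphi}$ is co-isometric if and only if $\varphi$ is a rotation $z\mapsto\lambda z$, $|\lambda|=1$, and $F$ is a constant function of modulus one. -/

import Mathlib

namespace WCO

/-- The open unit disk of the complex plane, as a set. -/
abbrev disk : Set ℂ := Metric.ball (0 : ℂ) 1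

/-- Every element of the function space `H` is an analytic function on the disk. -/
def IsAnalyticSpace (H : Type*) [NormedAddCommGroup H] [InnerProductSpace ℂ H]
    [RKHS ℂ H disk ℂ] : Prop :=
  ∀ f : H, ∃ g : ℂ → ℂ, AnalyticOnNhd ℂ g disk ∧ ∀ z : disk, f z = g z

/-- The reproducing kernel `K_w` of `H` at `w`: the element of `H` with `f w = ⟨f, K_w⟩`
(linear in `f`) for all `f` in `H`. -/
noncomputable def kern (H : Type*) [NormedAddCommGroup H] [InnerProductSpace ℂ H]
    [CompleteSpace H] [RKHS ℂ H disk ℂ] (w : disk) : H :=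
  RKHS.kerFun H w 1

/-- The reproducing property (Mathlib's inner product is linear in the second argument). -/
theorem inner_kern {H : Type*} [NormedAddCommGroup H] [InnerProductSpace ℂ H]
    [CompleteSpace H] [RKHS ℂ H disk ℂ] (w : disk) (f : H) :
    inner ℂ (kern H w) f = f w := by
  simp [kern]

/-- The reproducing kernel has the form `K_w(z) = ∑ γ(n) (w̄ z)^n` with `γ(n) > 0`, `γ(0) = 1`. -/
def HasKernelCoeffs (H : Type*) [NormedAddCommGroup H] [InnerProductSpace ℂ H]
    [CompleteSpace H] [RKHS ℂ H disk ℂ] (γ : ℕ → ℝ) : Prop :=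
  (∀ n, 0 < γ n) ∧ γ 0 = 1 ∧
    ∀ w z : disk,
      HasSum (fun n : ℕ => (γ n : ℂ) * (starRingEnd ℂ (w : ℂ) * (z : ℂ)) ^ n) (kern H w z)

/-- `H` is the space `H_g` with kernel `K_w(z) = (1 - w̄ z)^(-g)`, `g > 0` (principal power; the
real part of `1 - w̄ z` is positive). -/
def IsConformalSpace (H : Type*) [NormedAddCommGroup H] [InnerProductSpace ℂ H]
    [CompleteSpace H] [RKHS ℂ H disk ℂ] (g : ℝ) : Prop :=
  0 < g ∧ ∀ w z : disk,
    kern H w z = (1 - starRingEnd ℂ (w : ℂ) * (z : ℂ)) ^ (-(g : ℂ))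

/-- The bounded operator `T` on `H` is the weighted composition operator `W_{F,φ}`,
`T f = F · (f ∘ φ)` on the disk. -/
def IsWCO {H : Type*} [NormedAddCommGroup H] [InnerProductSpace ℂ H]
    [RKHS ℂ H disk ℂ] (T : H →L[ℂ] H) (F φ : ℂ → ℂ) (hφ : Set.MapsTo φ disk disk) : Prop :=
  ∀ (f : H) (z : disk), T f z = F z * f ⟨φ z, hφ z.2⟩

/-- `T` is co-isometric: `T T* = I`. -/
def IsCoisometric {H : Type*} [NormedAddCommGroup H] [InnerProductSpace ℂ H]
    [CompleteSpace H] (T : H →L[ℂ] H) : Prop :=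
  T ∘L (ContinuousLinearMap.adjoint T) = ContinuousLinearMap.id ℂ H

/-- `φ` is a disk automorphism: an analytic bijection of the disk onto itself. -/
def IsDiskAutomorphism (φ : ℂ → ℂ) : Prop :=
  AnalyticOnNhd ℂ φ disk ∧ Set.BijOn φ disk disk

/-- `φ` is a rotation `z ↦ lam z`, `|lam| = 1`, on the disk. -/
def IsRotation (φ : ℂ → ℂ) : Prop :=
  ∃ lam : ℂ, ‖lam‖ = 1 ∧ ∀ z ∈ disk, φ z = lam * z

/-- `F` is constant of modulus one on the disk. -/
def IsUnimodularConst (F : ℂ → ℂ) : Prop :=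
  ∃ c : ℂ, ‖c‖ = 1 ∧ ∀ z ∈ disk, F z = c

/-- `G` is an analytic branch of the power `h ^ s` on the disk: `G = exp (s L)` for some analytic
logarithm `L` of `h` on the disk. -/
def IsPowerBranch (G h : ℂ → ℂ) (s : ℝ) : Prop :=
  ∃ L : ℂ → ℂ, AnalyticOnNhd ℂ L disk ∧
    ∀ z ∈ disk, Complex.exp (L z) = h z ∧ G z = Complex.exp ((s : ℂ) * L z)

/-- `F = μ (φ')^(g/2)` on the disk for some constant `μ` of modulus one. Any two branches of the
power differ by a unimodular constant, so the choice of the branch does not matter. -/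
def IsDerivWeight (F φ : ℂ → ℂ) (g : ℝ) : Prop :=
  ∃ (G : ℂ → ℂ) (μ : ℂ), IsPowerBranch G (deriv φ) (g / 2) ∧ ‖μ‖ = 1 ∧
    ∀ z ∈ disk, F z = μ * G z

/-- `F = ν K_a / ‖K_a‖` on the disk, where `φ(a) = 0`, for some constant `ν` of modulus one. -/
def IsKernelWeight (H : Type*) [NormedAddCommGroup H] [InnerProductSpace ℂ H]
    [CompleteSpace H] [RKHS ℂ H disk ℂ] (F φ : ℂ → ℂ) : Prop :=
  ∃ (a : disk) (ν : ℂ), φ a = 0 ∧ ‖ν‖ = 1 ∧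
    ∀ z : disk, F z = ν * (kern H a z / (‖kern H a‖ : ℂ))

end WCO

/-!
Write `K_w(z) = k(w̄ z)` with `k(x) = ∑ γ(n) xⁿ`. Since `T* K_w = conj (F w) K_{φ w}`, the operator
`T = W_{F,φ}` is co-isometric if and only if
`F(z) conj(F(w)) k(conj(φ(w)) φ(z)) = k(w̄ z)` for all `z, w` in the disk
(`IsWCO.isCoisometric_iff`). Everything is read off from this equation.

With `s = w̄`, compare the derivatives of order `0, 1, 2` in `s` at `s = 0`. Put `b = φ(0)`.
If `b = 0`, these say that `F` is constant and that `conj(φ'(0)) φ(z) = z`. If `b ≠ 0`, order `0`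
gives `F(z)` and order `1` gives `z` in terms of `y = φ(z)`; substituting both into order `2` leaves
an identity in `y` alone, which by the identity theorem is a differential equation for `k` on a disk
about `0`. Regularity at the origin reduces it to `γ(1)² k k'' = k''(0) k'²`
(`quadratic_ode_of_euler`). Then `k / k'` has constant derivative, so that `(1 - α x) k' = γ(1) k`
with `α` real (`linear_ode_of_quadratic_ode`), and order `1` becomes the Möbius relation
`z (1 - α b̄ φ(z)) = η (φ(z) - b)` with `|η| = 1` (`mobius_relation`).
Positivity of all the coefficients gives `α ≥ 0`, analyticity of `k` on the disk gives `α ≤ 1`, and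
`φ` mapping the disk into itself gives `α ≥ 1` (`one_le_of_mobius_relation`). Hence
`k(x) = (1 - x)^(-γ(1))` and `φ` is a disk automorphism; see `rotation_or_mobius`.

In all cases `φ` is onto and `F` has no zeros, so a co-isometric `T` is injective and therefore
unitary (`IsWCO.mem_unitary_iff`). Putting `φ(w) = 0` in the equation yields `F = ν K_a / ‖K_a‖`.
Conversely, on `H_g` the equation for a disk automorphism is the power `-g` of the Möbius identity
for `1 - conj(φ(w)) φ(z)` (`cpow_one_sub_conj_mobius_mul_mobius`), every disk automorphism being a
rotated Möbius map by the Schwarz lemma (`IsDiskAutomorphism.eq_mobius`). The two descriptions of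
the weight agree because `φ'` is a constant multiple of `(1 - ā z)^(-2)`.
-/

namespace WCO

open Filter Topology Complex ComplexConjugate

/-! ### Power series kernels and their differential equations -/

lemma mem_disk {z : ℂ} : z ∈ disk ↔ ‖z‖ < 1 := by simp [disk]

lemma zero_mem_disk : (0 : ℂ) ∈ disk := by simp [disk]

lemma isPreconnected_disk : IsPreconnected disk := (convex_ball (0 : ℂ) 1).isPreconnected

lemma disk_mem_nhds {z : ℂ} (hz : z ∈ disk) : disk ∈ 𝓝 z := Metric.isOpen_ball.mem_nhds hz

lemma conj_mem_disk {z : ℂ} (hz : z ∈ disk) : conj z ∈ disk := by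
  simpa [mem_disk] using hz

lemma mul_mem_disk {z w : ℂ} (hz : z ∈ disk) (hw : w ∈ disk) : z * w ∈ disk := by
  rw [mem_disk] at *
  rw [norm_mul]
  exact mul_lt_one_of_nonneg_of_lt_one_left (norm_nonneg _) hz hw.le

/-- The one-variable power series `∑ γ(n) x ^ n` with `K_w(z) = kernelSeries γ (w̄ z)`. -/
noncomputable def kernelSeries (γ : ℕ → ℝ) (x : ℂ) : ℂ := ∑' n, (γ n : ℂ) * x ^ n

section Series

variable {γ : ℕ → ℝ}

lemma hasFPowerSeriesOnBall_kernelSeries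
    (hs : ∀ x ∈ disk, Summable fun n => (γ n : ℂ) * x ^ n) :
    HasFPowerSeriesOnBall (kernelSeries γ)
      (FormalMultilinearSeries.ofScalars ℂ fun n => (γ n : ℂ)) 0 1 where
  r_le := by
    refine ENNReal.le_of_forall_nnreal_lt fun r hr => ?_
    refine FormalMultilinearSeries.le_radius_of_summable _ ?_
    have hr1 : ((r : ℝ) : ℂ) ∈ disk := by
      have : r < 1 := by exact_mod_cast hr
      simpa [mem_disk] using this
    simpa [FormalMultilinearSeries.ofScalars_norm] using (hs _ hr1).norm
  r_pos := one_pos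
  hasSum := by
    intro y hy
    have hy' : y ∈ disk := by
      rw [mem_disk]
      simpa [← ofReal_norm, ENNReal.ofReal_lt_one] using hy
    simpa [kernelSeries, mul_comm] using (hs y hy').hasSum

lemma analyticOnNhd_kernelSeries (hs : ∀ x ∈ disk, Summable fun n => (γ n : ℂ) * x ^ n) :
    AnalyticOnNhd ℂ (kernelSeries γ) disk := by
  have h := (hasFPowerSeriesOnBall_kernelSeries hs).analyticOnNhd
  intro x hx
  refine h x ?_
  rw [mem_disk] at hx
  simpa [← ofReal_norm, ENNReal.ofReal_lt_one] using hx

lemma iteratedDeriv_kernelSeries_zero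
    (hs : ∀ x ∈ disk, Summable fun n => (γ n : ℂ) * x ^ n) (n : ℕ) :
    iteratedDeriv n (kernelSeries γ) 0 = n.factorial * γ n := by
  have h1 := (hasFPowerSeriesOnBall_kernelSeries hs).hasFPowerSeriesAt
  have h2 := (analyticOnNhd_kernelSeries hs 0 zero_mem_disk).hasFPowerSeriesAt
  have h3 := (FormalMultilinearSeries.ofScalars_series_eq_iff ℂ _ _).1
    (h1.eq_formalMultilinearSeries h2)
  have h4 := congrFun h3 n
  have : (n.factorial : ℂ) ≠ 0 := by exact_mod_cast n.factorial_ne_zero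
  rw [h4]
  field_simp

lemma one_le_re_kernelSeries (hpos : ∀ n, 0 < γ n) (h0 : γ 0 = 1)
    (hs : ∀ x ∈ disk, Summable fun n => (γ n : ℂ) * x ^ n) {x : ℝ} (hx0 : 0 ≤ x) (hx : x < 1) :
    1 ≤ (kernelSeries γ x).re := by
  have hx' : (x : ℂ) ∈ disk := by simpa [mem_disk, abs_of_nonneg hx0] using hx
  have h := Complex.hasSum_re (hs _ hx').hasSum
  have h' : HasSum (fun n => γ n * x ^ n) (kernelSeries γ x).re := by
    rw [kernelSeries]
    convert h using 2 with n
    rw [← Complex.ofReal_pow, ← Complex.ofReal_mul, Complex.ofReal_re]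
  have := le_hasSum h' 0 fun n _ => mul_nonneg (hpos n).le (pow_nonneg hx0 n)
  simpa [h0] using this

/-- A solution `k` of `(1 - α x) k' = g k` on the disk has derivatives at `0` in the ratio
`g + α n`; this is the recursion `(n + 1) γ(n + 1) = (g + α n) γ(n)` for its coefficients. -/
lemma iteratedDeriv_succ_of_linear_ode {k : ℂ → ℂ} (hk : AnalyticOnNhd ℂ k disk) {α g : ℂ}
    (hode : ∀ x ∈ disk, (1 - α * x) * deriv k x = g * k x) (n : ℕ) :
    ∀ x ∈ disk, (1 - α * x) * iteratedDeriv (n + 1) k x = (g + α * n) * iteratedDeriv n k x := by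
  have hd : ∀ n, AnalyticOnNhd ℂ (iteratedDeriv n k) disk := fun n => by
    rw [iteratedDeriv_eq_iterate]
    exact hk.iterated_deriv n
  induction n with
  | zero => simpa using hode
  | succ n ih =>
    intro x hx
    have hev : (fun x => (1 - α * x) * iteratedDeriv (n + 1) k x) =ᶠ[𝓝 x]
        fun x => (g + α * n) * iteratedDeriv n k x := by
      filter_upwards [disk_mem_nhds hx] with y hy using ih y hy
    have h1 : HasDerivAt (fun x => (1 - α * x) * iteratedDeriv (n + 1) k x)
        ((-α) * iteratedDeriv (n + 1) k x + (1 - α * x) * iteratedDeriv (n + 2) k x) x := by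
      have ha : HasDerivAt (fun x : ℂ => 1 - α * x) (-α) x := by
        simpa using ((hasDerivAt_id x).const_mul α).const_sub 1
      have hb := (hd (n + 1) x hx).differentiableAt.hasDerivAt
      rw [← iteratedDeriv_succ] at hb
      exact ha.mul hb
    have h2 : HasDerivAt (fun x => (g + α * n) * iteratedDeriv n k x)
        ((g + α * n) * iteratedDeriv (n + 1) k x) x := by
      have hb := (hd n x hx).differentiableAt.hasDerivAt
      rw [← iteratedDeriv_succ] at hb
      exact hb.const_mul _
    have := h1.unique (h2.congr_of_eventuallyEq hev)
    push_cast
    linear_combination this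

end Series

/-- An analytic solution of `g² k k'' = κ k'²` near `0` with `k(0) = 1`, `k'(0) = g ≠ 0` satisfies a
linear equation of first order, because `(k / k')' = 1 - κ / g²` is constant. -/
lemma linear_ode_of_quadratic_ode {k : ℂ → ℂ} (hk : AnalyticOnNhd ℂ k disk) {g κ : ℂ}
    (h0 : k 0 = 1) (h1 : deriv k 0 = g) (hg : g ≠ 0)
    (hode : ∀ᶠ x in 𝓝 0, g ^ 2 * (k x * deriv (deriv k) x) = κ * deriv k x ^ 2) :
    ∀ x ∈ disk, (1 - (κ / g - g) * x) * deriv k x = g * k x := by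
  have hk1 : AnalyticOnNhd ℂ (deriv k) disk := hk.deriv
  have hne : ∀ᶠ x in 𝓝 0, deriv k x ≠ 0 :=
    (hk1 0 zero_mem_disk).continuousAt.eventually_ne (by rwa [h1])
  obtain ⟨r, hr, hball⟩ := Metric.eventually_nhds_iff_ball.1
    ((hode.and hne).and (disk_mem_nhds zero_mem_disk))
  have hder : ∀ x ∈ Metric.ball (0 : ℂ) r,
      HasDerivAt (fun x => k x / deriv k x - (1 - κ / g ^ 2) * x) 0 x := by
    intro x hx
    obtain ⟨⟨ho, hn⟩, hx1⟩ := hball x hx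
    have ha := (hk x hx1).differentiableAt.hasDerivAt
    have hb := (hk1 x hx1).differentiableAt.hasDerivAt
    have := (ha.div hb hn).sub ((hasDerivAt_id x).const_mul (1 - κ / g ^ 2))
    refine this.congr_deriv ?_
    field_simp
    linear_combination -ho
  have hconst : ∀ x ∈ Metric.ball (0 : ℂ) r,
      k x / deriv k x - (1 - κ / g ^ 2) * x = 1 / g := by
    intro x hx
    have := Metric.isOpen_ball.is_const_of_deriv_eq_zero (convex_ball (0 : ℂ) r).isPreconnected
      (fun y hy => (hder y hy).differentiableAt.differentiableWithinAt)
      (fun y hy => (hder y hy).deriv) hx (Metric.mem_ball_self hr)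
    rw [this, h0, h1]
    simp
  have hloc : (fun x => (1 - (κ / g - g) * x) * deriv k x) =ᶠ[𝓝 0] fun x => g * k x := by
    filter_upwards [Metric.ball_mem_nhds (0 : ℂ) hr] with x hx
    have hn := (hball x hx).1.2
    have := hconst x hx
    field_simp at this ⊢
    linear_combination -this
  have hA : AnalyticOnNhd ℂ (fun x => (1 - (κ / g - g) * x) * deriv k x) disk :=
    (analyticOnNhd_const.sub (analyticOnNhd_const.mul analyticOnNhd_id)).mul hk1
  have hB : AnalyticOnNhd ℂ (fun x => g * k x) disk := analyticOnNhd_const.mul hk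
  exact hA.eqOn_of_preconnected_of_eventuallyEq hB isPreconnected_disk zero_mem_disk hloc

/-- In a homogeneous quadratic Euler equation of second order, regularity at the origin kills the
terms of order less than two. -/
lemma quadratic_ode_of_euler {k : ℂ → ℂ} (hk : AnalyticOnNhd ℂ k disk) {A B C D : ℂ}
    (h0 : k 0 = 1) (h1 : deriv k 0 ≠ 0)
    (hode : ∀ᶠ x in 𝓝 0, A * k x ^ 2 + B * (x * (k x * deriv k x))
      + C * (x ^ 2 * (k x * deriv (deriv k) x)) = D * (x ^ 2 * deriv k x ^ 2)) :
    ∀ᶠ x in 𝓝[≠] 0, C * (k x * deriv (deriv k) x) = D * deriv k x ^ 2 := by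
  have hk1 : AnalyticOnNhd ℂ (deriv k) disk := hk.deriv
  have hk2 : AnalyticOnNhd ℂ (deriv (deriv k)) disk := hk1.deriv
  have hA : A = 0 := by simpa [h0] using hode.self_of_nhds
  subst hA
  have hdiv : ∀ᶠ x in 𝓝[≠] (0 : ℂ), B * (k x * deriv k x)
      + x * (C * (k x * deriv (deriv k) x) - D * deriv k x ^ 2) = 0 := by
    filter_upwards [hode.filter_mono nhdsWithin_le_nhds, self_mem_nhdsWithin] with x hx hx0
    refine mul_left_cancel₀ (show x ≠ 0 from hx0) ?_
    linear_combination hx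
  have c0 := (hk 0 zero_mem_disk).continuousAt
  have c1 := (hk1 0 zero_mem_disk).continuousAt
  have c2 := (hk2 0 zero_mem_disk).continuousAt
  have hcont : ContinuousAt (fun x => B * (k x * deriv k x)
      + x * (C * (k x * deriv (deriv k) x) - D * deriv k x ^ 2)) 0 := by fun_prop
  have hB : B = 0 := by
    have hlim := hcont.tendsto.mono_left (nhdsWithin_le_nhds (s := {0}ᶜ))
    have hlim' := tendsto_nhds_unique hlim
      ((tendsto_const_nhds (x := (0 : ℂ))).congr' (hdiv.mono fun x hx => hx.symm))
    simpa [h0, h1] using hlim'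
  subst hB
  filter_upwards [hdiv, self_mem_nhdsWithin] with x hx hx0
  refine mul_left_cancel₀ (show x ≠ 0 from hx0) ?_
  linear_combination hx

/-! ### Jets of the kernel equation -/

section Jets

variable {F f φ ψ k : ℂ → ℂ}

lemma hasDerivAt_comp_mul_const {h : ℂ → ℂ} (hh : AnalyticOnNhd ℂ h disk)
    (hψ : AnalyticOnNhd ℂ ψ disk) (hψm : Set.MapsTo ψ disk disk) {y s : ℂ} (hy : y ∈ disk)
    (hs : s ∈ disk) :
    HasDerivAt (fun s => h (ψ s * y)) (deriv h (ψ s * y) * (deriv ψ s * y)) s :=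
  (hh _ (mul_mem_disk (hψm hs) hy)).differentiableAt.hasDerivAt.comp s
    ((hψ s hs).differentiableAt.hasDerivAt.mul_const y)

/-- First derivative in `s` of `F(z) f(s) k(ψ(s) φ(z)) = k(s z)`. -/
lemma first_jet (hk : AnalyticOnNhd ℂ k disk) (hf : AnalyticOnNhd ℂ f disk)
    (hψ : AnalyticOnNhd ℂ ψ disk) (hφm : Set.MapsTo φ disk disk) (hψm : Set.MapsTo ψ disk disk)
    (hid : ∀ z ∈ disk, ∀ s ∈ disk, F z * f s * k (ψ s * φ z) = k (s * z))
    {z s : ℂ} (hz : z ∈ disk) (hs : s ∈ disk) :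
    F z * (deriv f s * k (ψ s * φ z) + f s * (deriv k (ψ s * φ z) * (deriv ψ s * φ z)))
      = deriv k (s * z) * z := by
  have h1 : HasDerivAt (fun s => F z * (f s * k (ψ s * φ z)))
      (F z * (deriv f s * k (ψ s * φ z) + f s * (deriv k (ψ s * φ z) * (deriv ψ s * φ z)))) s :=
    ((hf s hs).differentiableAt.hasDerivAt.mul
      (hasDerivAt_comp_mul_const hk hψ hψm (hφm hz) hs)).const_mul _
  have h2 : HasDerivAt (fun s => k (s * z)) (deriv k (s * z) * z) s := by
    simpa using hasDerivAt_comp_mul_const hk analyticOnNhd_id (Set.mapsTo_id _) hz hs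
  refine h1.unique (h2.congr_of_eventuallyEq ?_)
  filter_upwards [disk_mem_nhds hs] with t ht
  rw [← hid z hz t ht]
  ring

/-- Second derivative in `s`, at `0`, of `F(z) f(s) k(ψ(s) φ(z)) = k(s z)`. -/
lemma second_jet (hk : AnalyticOnNhd ℂ k disk) (hf : AnalyticOnNhd ℂ f disk)
    (hψ : AnalyticOnNhd ℂ ψ disk) (hφm : Set.MapsTo φ disk disk) (hψm : Set.MapsTo ψ disk disk)
    (hid : ∀ z ∈ disk, ∀ s ∈ disk, F z * f s * k (ψ s * φ z) = k (s * z))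
    {z : ℂ} (hz : z ∈ disk) :
    F z * (deriv (deriv f) 0 * k (ψ 0 * φ z)
        + (2 * deriv f 0 * deriv ψ 0 + f 0 * deriv (deriv ψ) 0) * (φ z * deriv k (ψ 0 * φ z))
        + f 0 * deriv ψ 0 ^ 2 * (φ z ^ 2 * deriv (deriv k) (ψ 0 * φ z)))
      = deriv (deriv k) 0 * z ^ 2 := by
  have h0 := zero_mem_disk
  have hkd := hasDerivAt_comp_mul_const hk hψ hψm (hφm hz) h0
  have hk'd := hasDerivAt_comp_mul_const hk.deriv hψ hψm (hφm hz) h0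
  have hfd := (hf 0 h0).differentiableAt.hasDerivAt
  have hf'd := (hf.deriv 0 h0).differentiableAt.hasDerivAt
  have hψ'd := (hψ.deriv 0 h0).differentiableAt.hasDerivAt
  have h1 := ((hf'd.mul hkd).add (hfd.mul (hk'd.mul (hψ'd.mul_const (φ z))))).const_mul (F z)
  have h2 : HasDerivAt (fun s => deriv k (s * z) * z) (deriv (deriv k) (0 * z) * z * z) 0 := by
    simpa [mul_assoc] using
      (hasDerivAt_comp_mul_const hk.deriv analyticOnNhd_id (Set.mapsTo_id _) hz h0).mul_const z
  have h3 := h1.unique (h2.congr_of_eventuallyEq (by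
    filter_upwards [disk_mem_nhds h0] with t ht
    exact first_jet hk hf hψ hφm hψm hid hz ht))
  rw [zero_mul] at h3
  simp only [Pi.mul_apply] at h3
  linear_combination h3

/-- Eliminating `F(z)` and `z` from the jets of order at most two leaves a differential equation for
`k` alone. -/
lemma exists_linear_ode (hk : AnalyticOnNhd ℂ k disk) (hf : AnalyticOnNhd ℂ f disk)
    (hψ : AnalyticOnNhd ℂ ψ disk) (hφ : AnalyticOnNhd ℂ φ disk)
    (hφm : Set.MapsTo φ disk disk) (hψm : Set.MapsTo ψ disk disk)
    (hid : ∀ z ∈ disk, ∀ s ∈ disk, F z * f s * k (ψ s * φ z) = k (s * z))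
    (h0 : k 0 = 1) (h1 : deriv k 0 ≠ 0) (hφ' : deriv φ 0 ≠ 0) (hψ' : deriv ψ 0 ≠ 0)
    (hb : ψ 0 ≠ 0) :
    ∀ x ∈ disk, (1 - (deriv (deriv k) 0 / deriv k 0 - deriv k 0) * x) * deriv k x
      = deriv k 0 * k x := by
  have h0m := zero_mem_disk
  have hk1 := hk.deriv
  have hk2 := hk1.deriv
  have hf0 : f 0 ≠ 0 := by
    have := hid 0 h0m 0 h0m
    rw [mul_zero, h0] at this
    intro h
    simp [h] at this
  set g := deriv k 0 with hg
  set κ := deriv (deriv k) 0 with hκ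
  set b := ψ 0 with hbdef
  set f0 := f 0
  set f1 := deriv f 0
  set f2 := deriv (deriv f) 0
  set c := deriv ψ 0
  set m := 2 * f1 * c + f0 * deriv (deriv ψ) 0 with hm
  have hbm : b ∈ disk := hψm h0m
  have hrange : ∀ z ∈ disk, g ^ 2 * f0 * k (b * φ z) * (f2 * k (b * φ z)
      + m * (φ z * deriv k (b * φ z)) + f0 * c ^ 2 * (φ z ^ 2 * deriv (deriv k) (b * φ z)))
      = κ * (f1 * k (b * φ z) + f0 * (deriv k (b * φ z) * (c * φ z))) ^ 2 := by
    intro z hz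
    have e0 := hid z hz 0 h0m
    have e1 := first_jet hk hf hψ hφm hψm hid hz h0m
    have e2 := second_jet hk hf hψ hφm hψm hid hz
    rw [zero_mul, h0] at e0
    rw [zero_mul] at e1
    have hFz : F z ≠ 0 := by
      intro h
      simp [h] at e0
    refine mul_left_cancel₀ (pow_ne_zero 2 hFz) ?_
    linear_combination g ^ 2 * (F z * (f2 * k (b * φ z)
      + m * (φ z * deriv k (b * φ z)) + f0 * c ^ 2 * (φ z ^ 2 * deriv (deriv k) (b * φ z)))) * e0
      + g ^ 2 * e2 - κ * (F z * (f1 * k (b * φ z) + f0 * (deriv k (b * φ z) * (c * φ z)))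
        + g * z) * e1
  -- As `φ'(0) ≠ 0`, the values `φ(z)` fill a neighbourhood of `φ(0)`.
  have hnear : ∀ᶠ y in 𝓝 (φ 0), g ^ 2 * f0 * k (b * y) * (f2 * k (b * y)
      + m * (y * deriv k (b * y)) + f0 * c ^ 2 * (y ^ 2 * deriv (deriv k) (b * y)))
      = κ * (f1 * k (b * y) + f0 * (deriv k (b * y) * (c * y))) ^ 2 := by
    have hstrict : HasStrictDerivAt φ (deriv φ 0) 0 := (hφ 0 h0m).hasStrictDerivAt
    rw [← hstrict.map_nhds_eq hφ', eventually_map]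
    filter_upwards [disk_mem_nhds h0m] with z hz using hrange z hz
  have hmul : AnalyticOnNhd ℂ (fun y => b * y) disk := analyticOnNhd_const.mul analyticOnNhd_id
  have hmaps : Set.MapsTo (fun y => b * y) disk disk := fun y hy => mul_mem_disk hbm hy
  have a0 : AnalyticOnNhd ℂ (fun y => k (b * y)) disk := hk.comp hmul hmaps
  have a1 : AnalyticOnNhd ℂ (fun y => deriv k (b * y)) disk := hk1.comp hmul hmaps
  have a2 : AnalyticOnNhd ℂ (fun y => deriv (deriv k) (b * y)) disk := hk2.comp hmul hmaps
  have hdisk := AnalyticOnNhd.eqOn_of_preconnected_of_eventuallyEq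
    (f := fun y => g ^ 2 * f0 * k (b * y) * (f2 * k (b * y)
      + m * (y * deriv k (b * y)) + f0 * c ^ 2 * (y ^ 2 * deriv (deriv k) (b * y))))
    (g := fun y => κ * (f1 * k (b * y) + f0 * (deriv k (b * y) * (c * y))) ^ 2)
    (fun y hy => ((analyticAt_const.mul (a0 y hy)).mul
      (((analyticAt_const.mul (a0 y hy)).add (analyticAt_const.mul (analyticAt_id.mul (a1 y hy)))).add
        (analyticAt_const.mul ((analyticAt_id.pow 2).mul (a2 y hy))))))
    (fun y hy => analyticAt_const.mul (((analyticAt_const.mul (a0 y hy)).add (analyticAt_const.mul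
      ((a1 y hy).mul (analyticAt_const.mul analyticAt_id)))).pow 2))
    isPreconnected_disk (hφm h0m) hnear
  -- In the variable `x = b y` this is an Euler equation for `k`.
  have heuler : ∀ᶠ x in 𝓝 (0 : ℂ), (g ^ 2 * f0 * f2 - κ * f1 ^ 2) * k x ^ 2
      + ((g ^ 2 * f0 * m - 2 * κ * f1 * f0 * c) / b) * (x * (k x * deriv k x))
      + (g ^ 2 * (f0 ^ 2 * c ^ 2 / b ^ 2)) * (x ^ 2 * (k x * deriv (deriv k) x))
      = (κ * (f0 ^ 2 * c ^ 2 / b ^ 2)) * (x ^ 2 * deriv k x ^ 2) := by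
    have hcont : Tendsto (fun x : ℂ => x / b) (𝓝 0) (𝓝 0) := by
      simpa using (continuous_id.div_const b).tendsto (0 : ℂ)
    filter_upwards [hcont (disk_mem_nhds h0m)] with x hx
    have := hdisk hx
    simp only [mul_div_cancel₀ x hb] at this
    field_simp at this ⊢
    linear_combination this
  have hquad : ∀ᶠ x in 𝓝 0, g ^ 2 * (k x * deriv (deriv k) x) = κ * deriv k x ^ 2 := by
    rw [← nhdsNE_sup_pure, eventually_sup, eventually_pure]
    refine ⟨?_, by rw [h0, ← hg, ← hκ]; ring⟩
    filter_upwards [quadratic_ode_of_euler hk h0 h1 heuler] with x hx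
    have : f0 ^ 2 * c ^ 2 / b ^ 2 ≠ 0 := by positivity
    refine mul_left_cancel₀ this ?_
    linear_combination hx
  exact linear_ode_of_quadratic_ode hk h0 rfl h1 hquad

/-- Under the linear equation `(1 - α x) k' = g k`, the first jet expresses `z` as a Möbius function
of `φ(z)`. -/
lemma mobius_relation (hk : AnalyticOnNhd ℂ k disk) (hf : AnalyticOnNhd ℂ f disk)
    (hψ : AnalyticOnNhd ℂ ψ disk) (hφm : Set.MapsTo φ disk disk) (hψm : Set.MapsTo ψ disk disk)
    (hid : ∀ z ∈ disk, ∀ s ∈ disk, F z * f s * k (ψ s * φ z) = k (s * z))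
    (h0 : k 0 = 1) (h1 : deriv k 0 ≠ 0) {α : ℂ}
    (hode : ∀ x ∈ disk, (1 - α * x) * deriv k x = deriv k 0 * k x) {z : ℂ} (hz : z ∈ disk) :
    z * (1 - α * (ψ 0 * φ 0)) * (1 - α * (ψ 0 * φ z)) = deriv ψ 0 * (φ z - φ 0) := by
  have h0m := zero_mem_disk
  have key : ∀ z ∈ disk, z * deriv k 0 * f 0 * (1 - α * (ψ 0 * φ z))
      = deriv f 0 * (1 - α * (ψ 0 * φ z)) + f 0 * deriv ψ 0 * φ z * deriv k 0 := by
    intro z hz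
    have e0 := hid z hz 0 h0m
    have e1 := first_jet hk hf hψ hφm hψm hid hz h0m
    have e2 := hode _ (mul_mem_disk (hψm h0m) (hφm hz))
    rw [zero_mul, h0] at e0
    rw [zero_mul] at e1
    have hkz : F z * k (ψ 0 * φ z) ≠ 0 := by
      intro h
      have : F z * f 0 * k (ψ 0 * φ z) = 0 := by linear_combination f 0 * h
      simp [this] at e0
    refine mul_left_cancel₀ hkz ?_
    linear_combination (z * deriv k 0 * (1 - α * (ψ 0 * φ z))) * e0
      - (1 - α * (ψ 0 * φ z)) * e1 + F z * f 0 * deriv ψ 0 * φ z * e2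
  have k1 := key z hz
  have k0 := key 0 h0m
  have hf0 : f 0 ≠ 0 := by
    have := hid 0 h0m 0 h0m
    rw [mul_zero, h0] at this
    intro h
    simp [h] at this
  refine mul_left_cancel₀ (mul_ne_zero h1 hf0) ?_
  linear_combination (1 - α * (ψ 0 * φ 0)) * k1 - (1 - α * (ψ 0 * φ z)) * k0

end Jets

/-! ### Automorphisms of the disk -/

/-- The disk automorphism `z ↦ (z - a) / (1 - ā z)` taking `a` to `0`; its inverse is `mobius (-a)`. -/
noncomputable def mobius (a z : ℂ) : ℂ := (z - a) / (1 - conj a * z)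

lemma re_one_sub_pos {x : ℂ} (hx : x ∈ disk) : 0 < (1 - x).re := by
  have := (Complex.re_le_norm x).trans_lt (mem_disk.1 hx)
  simpa using this

lemma one_sub_ne_zero {x : ℂ} (hx : x ∈ disk) : 1 - x ≠ 0 := by
  intro h
  have := re_one_sub_pos hx
  simp [h] at this

lemma one_sub_conj_mul_ne_zero {a z : ℂ} (ha : a ∈ disk) (hz : z ∈ disk) : 1 - conj a * z ≠ 0 :=
  one_sub_ne_zero (mul_mem_disk (conj_mem_disk ha) hz)

lemma one_sub_conj_mul_self_eq (a : ℂ) : 1 - conj a * a = ((1 - ‖a‖ ^ 2 : ℝ) : ℂ) := by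
  rw [Complex.conj_mul']
  push_cast
  rfl

lemma one_sub_norm_sq_pos {a : ℂ} (ha : a ∈ disk) : 0 < 1 - ‖a‖ ^ 2 := by
  have := mem_disk.1 ha
  nlinarith [norm_nonneg a]

/-- For `σ = mobius a`: `1 - conj (σ w) σ z = (1 - |a|²) (1 - w̄ z) / ((1 - ā z) (1 - a w̄))`. -/
lemma one_sub_conj_mobius_mul_mobius {a w z : ℂ} (ha : a ∈ disk) (hw : w ∈ disk) (hz : z ∈ disk) :
    (1 - conj (mobius a w) * mobius a z) * ((1 - conj a * z) * (1 - conj w * a))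
      = (1 - conj a * a) * (1 - conj w * z) := by
  have h1 := one_sub_conj_mul_ne_zero ha hz
  have h2 := one_sub_conj_mul_ne_zero hw ha
  have h3 : conj (mobius a w) = (conj w - conj a) / (1 - conj w * a) := by
    simp [mobius, mul_comm]
  rw [h3, mobius]
  field_simp
  ring

lemma mapsTo_mobius {a : ℂ} (ha : a ∈ disk) : Set.MapsTo (mobius a) disk disk := by
  intro z hz
  have h := one_sub_conj_mobius_mul_mobius ha hz hz
  have h4 : (1 - conj a * z) * (1 - conj z * a) = ((‖1 - conj a * z‖ ^ 2 : ℝ) : ℂ) := by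
    have : 1 - conj z * a = conj (1 - conj a * z) := by simp [mul_comm]
    rw [this, Complex.mul_conj']
    push_cast
    rfl
  rw [one_sub_conj_mul_self_eq, one_sub_conj_mul_self_eq, one_sub_conj_mul_self_eq, h4,
    ← Complex.ofReal_mul, ← Complex.ofReal_mul, Complex.ofReal_inj] at h
  have h5 : 0 < ‖1 - conj a * z‖ ^ 2 := by
    have := one_sub_conj_mul_ne_zero ha hz
    positivity
  have h6 : 0 < (1 - ‖mobius a z‖ ^ 2) * ‖1 - conj a * z‖ ^ 2 := by
    rw [h]
    exact mul_pos (one_sub_norm_sq_pos ha) (one_sub_norm_sq_pos hz)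
  have h7 := (mul_pos_iff_of_pos_right h5).1 h6
  rw [mem_disk]
  nlinarith [norm_nonneg (mobius a z)]

lemma neg_mem_disk {a : ℂ} (ha : a ∈ disk) : -a ∈ disk := by simpa [mem_disk] using ha

lemma mobius_neg_mobius {a z : ℂ} (ha : a ∈ disk) (hz : z ∈ disk) :
    mobius (-a) (mobius a z) = z := by
  have h1 : mobius a z * (1 - conj a * z) = z - a :=
    div_mul_cancel₀ _ (one_sub_conj_mul_ne_zero ha hz)
  have h2 := one_sub_conj_mul_ne_zero (neg_mem_disk ha) (mapsTo_mobius ha hz)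
  rw [mobius, div_eq_iff h2, map_neg]
  linear_combination h1

lemma mobius_mobius_neg {a z : ℂ} (ha : a ∈ disk) (hz : z ∈ disk) :
    mobius a (mobius (-a) z) = z := by
  simpa using mobius_neg_mobius (neg_mem_disk ha) hz

lemma hasDerivAt_mobius {a z : ℂ} (ha : a ∈ disk) (hz : z ∈ disk) :
    HasDerivAt (mobius a) ((1 - conj a * a) / (1 - conj a * z) ^ 2) z := by
  have h1 : HasDerivAt (fun z => z - a) 1 z := (hasDerivAt_id z).sub_const a
  have h2 : HasDerivAt (fun z => 1 - conj a * z) (-conj a) z := by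
    simpa using ((hasDerivAt_id z).const_mul (conj a)).const_sub 1
  refine (h1.div h2 (one_sub_conj_mul_ne_zero ha hz)).congr_deriv ?_
  congr 1
  ring

lemma differentiableOn_mobius {a : ℂ} (ha : a ∈ disk) : DifferentiableOn ℂ (mobius a) disk :=
  fun _ hz => (hasDerivAt_mobius ha hz).differentiableAt.differentiableWithinAt

lemma rotation_mem_disk {η z : ℂ} (hη : ‖η‖ = 1) (hz : z ∈ disk) : η * z ∈ disk := by
  rw [mem_disk] at *
  rwa [norm_mul, hη, one_mul]

lemma bijOn_rotation_mobius {η a : ℂ} (hη : ‖η‖ = 1) (ha : a ∈ disk) :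
    Set.BijOn (fun z => η * mobius a z) disk disk := by
  have hη0 : η ≠ 0 := by
    rintro rfl
    simp at hη
  have hη' : ‖η⁻¹‖ = 1 := by simp [hη]
  refine Set.InvOn.bijOn (f' := fun z => mobius (-a) (η⁻¹ * z)) ⟨?_, ?_⟩ ?_ ?_
  · intro z hz
    simp only [inv_mul_cancel_left₀ hη0]
    exact mobius_neg_mobius ha hz
  · intro z hz
    simp only
    rw [mobius_mobius_neg ha (rotation_mem_disk hη' hz), mul_inv_cancel_left₀ hη0]
  · exact fun z hz => rotation_mem_disk hη (mapsTo_mobius ha hz)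
  · exact fun z hz => mapsTo_mobius (neg_mem_disk ha) (rotation_mem_disk hη' hz)

lemma isDiskAutomorphism_of_eq_mobius {φ : ℂ → ℂ} (hφ : AnalyticOnNhd ℂ φ disk) {η a : ℂ}
    (hη : ‖η‖ = 1) (ha : a ∈ disk) (h : ∀ z ∈ disk, φ z = η * mobius a z) :
    IsDiskAutomorphism φ :=
  ⟨hφ, (bijOn_rotation_mobius hη ha).congr fun z hz => (h z hz).symm⟩

/-- The inverse of a disk automorphism is analytic: it is continuous by the open mapping theorem and
differentiable off the isolated critical values, which are then removable. -/
lemma IsDiskAutomorphism.exists_analytic_inverse {φ : ℂ → ℂ} (h : IsDiskAutomorphism φ) :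
    ∃ ψ : ℂ → ℂ, AnalyticOnNhd ℂ ψ disk ∧ Set.MapsTo ψ disk disk ∧ Set.InvOn ψ φ disk disk := by
  obtain ⟨hφ, hbij⟩ := h
  have hnc : ¬ ∃ w, ∀ z ∈ disk, φ z = w := by
    rintro ⟨w, hw⟩
    have h2 : (1 / 2 : ℂ) ∈ disk := by
      rw [mem_disk]
      norm_num
    have := hbij.injOn zero_mem_disk h2 ((hw _ zero_mem_disk).trans (hw _ h2).symm)
    norm_num at this
  have hopen := (hφ.is_constant_or_isOpen isPreconnected_disk).resolve_left hnc
  have hcrit : ∀ z ∈ disk, ∀ᶠ x in 𝓝[≠] z, deriv φ x ≠ 0 := by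
    intro z hz
    refine (hφ.deriv z hz).eventually_eq_zero_or_eventually_ne_zero.resolve_left fun h0 => hnc ?_
    have hzero := hφ.deriv.eqOn_zero_of_preconnected_of_eventuallyEq_zero isPreconnected_disk hz h0
    exact Metric.isOpen_ball.exists_is_const_of_deriv_eq_zero isPreconnected_disk
      hφ.differentiableOn hzero
  set ψ := Function.invFunOn φ disk with hψ
  have hinv : Set.InvOn ψ φ disk disk := hbij.invOn_invFunOn
  have hmaps : Set.MapsTo ψ disk disk := hbij.surjOn.mapsTo_invFunOn
  have hcont : ∀ w ∈ disk, ContinuousAt ψ w := by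
    intro w hw U hU
    obtain ⟨V, hVU, hVo, hwV⟩ := mem_nhds_iff.1 (inter_mem hU (disk_mem_nhds (hmaps hw)))
    have himg : φ '' V ∈ 𝓝 w := (hopen V (fun x hx => (hVU hx).2) hVo).mem_nhds
      ⟨ψ w, hwV, hinv.2 hw⟩
    rw [mem_map]
    filter_upwards [himg]
    rintro _ ⟨x, hx, rfl⟩
    rw [Set.mem_preimage, hinv.1 (hVU hx).2]
    exact (hVU hx).1
  refine ⟨ψ, fun w hw => ?_, hmaps, hinv⟩
  refine analyticAt_of_differentiable_on_punctured_nhds_of_continuousAt ?_ (hcont w hw)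
  have hne : ∀ᶠ v in 𝓝[≠] w, ψ v ≠ ψ w := by
    filter_upwards [self_mem_nhdsWithin, (disk_mem_nhds hw |> mem_nhdsWithin_of_mem_nhds)]
      with v hv hvd heq
    exact hv (hinv.2.injOn hvd hw heq)
  have htend : Tendsto ψ (𝓝[≠] w) (𝓝[≠] (ψ w)) :=
    tendsto_nhdsWithin_iff.2 ⟨(hcont w hw).tendsto.mono_left nhdsWithin_le_nhds, hne⟩
  filter_upwards [htend.eventually (hcrit _ (hmaps hw)),
    (disk_mem_nhds hw |> mem_nhdsWithin_of_mem_nhds)] with v hv hvd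
  refine (HasDerivAt.of_local_left_inverse (hcont v hvd)
    (hφ _ (hmaps hvd)).differentiableAt.hasDerivAt hv ?_).differentiableAt
  filter_upwards [disk_mem_nhds hvd] with x hx using hinv.2 hx

/-- Disk automorphisms are rotated Möbius maps, by the Schwarz lemma for the map and its inverse. -/
lemma IsDiskAutomorphism.eq_mobius {φ : ℂ → ℂ} (h : IsDiskAutomorphism φ) :
    ∃ η a : ℂ, ‖η‖ = 1 ∧ a ∈ disk ∧ ∀ z ∈ disk, φ z = η * mobius a z := by
  obtain ⟨ψ, hψ, hψm, hinv⟩ := h.exists_analytic_inverse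
  obtain ⟨hφ, hbij⟩ := h
  set a := ψ 0 with ha
  have ham : a ∈ disk := hψm zero_mem_disk
  have hna := neg_mem_disk ham
  have hmob0 : mobius (-a) 0 = a := by simp [mobius]
  have hφa : φ a = 0 := hinv.2 zero_mem_disk
  set Φ : ℂ → ℂ := fun z => φ (mobius (-a) z) with hΦ
  have hΦ0 : Φ 0 = 0 := by simp [hΦ, hmob0, hφa]
  have hΦm : Set.MapsTo Φ disk disk := fun z hz => hbij.mapsTo (mapsTo_mobius hna hz)
  have hΦd : DifferentiableOn ℂ Φ disk :=
    hφ.differentiableOn.comp (differentiableOn_mobius hna) (mapsTo_mobius hna)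
  set Ψ : ℂ → ℂ := fun z => mobius a (ψ z) with hΨ
  have hΨ0 : Ψ 0 = 0 := by simp [hΨ, ← ha, mobius]
  have hΨm : Set.MapsTo Ψ disk disk := fun z hz => mapsTo_mobius ham (hψm hz)
  have hΨd : DifferentiableOn ℂ Ψ disk :=
    (differentiableOn_mobius ham).comp hψ.differentiableOn hψm
  have hΨΦ : ∀ z ∈ disk, Ψ (Φ z) = z := by
    intro z hz
    simp only [hΨ, hΦ]
    rw [hinv.1 (mapsTo_mobius hna hz), mobius_mobius_neg ham hz]
  have hnorm : ∀ z ∈ disk, ‖Φ z‖ = ‖z‖ := by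
    intro z hz
    refine le_antisymm ?_ ?_
    · exact Complex.norm_le_norm_of_mapsTo_ball hΦd
        (hΦm.mono_right Metric.ball_subset_closedBall) hΦ0 (mem_disk.1 hz)
    · have := Complex.norm_le_norm_of_mapsTo_ball hΨd
        (hΨm.mono_right Metric.ball_subset_closedBall) hΨ0 (mem_disk.1 (hΦm hz))
      rwa [hΨΦ z hz] at this
  have h2 : (1 / 2 : ℂ) ∈ disk := by
    rw [mem_disk]
    norm_num
  have hslope : ‖dslope Φ 0 (1 / 2)‖ = 1 / 1 := by
    rw [dslope_of_ne _ (by norm_num), slope_def_field, hΦ0, sub_zero, sub_zero, norm_div,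
      hnorm _ h2]
    norm_num
  have haff := Complex.affine_of_mapsTo_ball_of_norm_dslope_eq_div hΦd
    (by rw [hΦ0]; exact hΦm.mono_right Metric.ball_subset_closedBall) h2 hslope
  refine ⟨dslope Φ 0 (1 / 2), a, by simpa using hslope, ham, fun z hz => ?_⟩
  have := haff (mapsTo_mobius ham hz)
  simp only [hΦ0, zero_add, sub_zero, smul_eq_mul] at this
  rw [mul_comm, ← this]
  simp only [hΦ]
  rw [mobius_neg_mobius ham hz]

/-! ### Rigidity of the kernel equation -/

/-- The solution of `(1 - x) k' = g k`, `k(0) = 1`, on the disk is `(1 - x) ^ (-g)`. -/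
lemma eq_one_sub_cpow_of_linear_ode {k : ℂ → ℂ} (hk : AnalyticOnNhd ℂ k disk) (h0 : k 0 = 1)
    {g : ℂ} (hode : ∀ x ∈ disk, (1 - x) * deriv k x = g * k x) :
    ∀ x ∈ disk, k x = (1 - x) ^ (-g) := by
  have hder : ∀ x ∈ disk, HasDerivAt (fun x => k x * (1 - x) ^ g) 0 x := by
    intro x hx
    have h1 : HasDerivAt (fun x : ℂ => 1 - x) (-1) x := (hasDerivAt_id x).const_sub 1
    have h2 := h1.cpow_const (c := g) (Or.inl (re_one_sub_pos hx))
    refine ((hk x hx).differentiableAt.hasDerivAt.mul h2).congr_deriv ?_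
    have hne := one_sub_ne_zero hx
    rw [Complex.cpow_sub _ _ hne, Complex.cpow_one]
    have := hode x hx
    field_simp
    linear_combination (1 - x) ^ g * this
  intro x hx
  have := Metric.isOpen_ball.is_const_of_deriv_eq_zero isPreconnected_disk
    (fun y hy => (hder y hy).differentiableAt.differentiableWithinAt)
    (fun y hy => (hder y hy).deriv) hx zero_mem_disk
  simp only [h0, sub_zero, Complex.one_cpow, mul_one] at this
  rw [Complex.cpow_neg]
  exact eq_inv_of_mul_eq_one_left this

/-- A self-map of the disk of the form prescribed by `z (1 - α b̄ y) = η (y - b)` with `b ≠ 0` forces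
`α ≥ 1`: otherwise `φ` leaves the disk as `z` approaches the boundary point `η b / |b|`. -/
lemma one_le_of_mobius_relation {φ : ℂ → ℂ} (hφm : Set.MapsTo φ disk disk) {η b : ℂ} {α : ℝ}
    (hη : ‖η‖ = 1) (hb : b ∈ disk) (hb0 : b ≠ 0) (hα : 0 ≤ α)
    (hrel : ∀ z ∈ disk, z * (1 - α * (conj b * φ z)) = η * (φ z - b)) : 1 ≤ α := by
  by_contra! hlt
  have hbn : 0 < ‖b‖ := norm_pos_iff.2 hb0
  have hb1 : ‖b‖ < 1 := mem_disk.1 hb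
  have hden : 0 < 1 - α * ‖b‖ := by nlinarith
  -- If `α < 1`, the relation gives `|φ(z)| = 1` at `z = r η b / |b|` already for this `r < 1`.
  set r : ℝ := (1 - ‖b‖) / (1 - α * ‖b‖) with hr
  have hr0 : 0 < r := div_pos (by linarith) hden
  have hr1 : r < 1 := (div_lt_one hden).2 (by nlinarith)
  have hreq : r * (1 - α * ‖b‖) = 1 - ‖b‖ := div_mul_cancel₀ _ hden.ne'
  have hbc : (‖b‖ : ℂ) ≠ 0 := by exact_mod_cast hbn.ne'
  set z : ℂ := r / ‖b‖ * η * b with hz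
  have hzn : ‖z‖ = r := by
    rw [hz, norm_mul, norm_mul, norm_div, hη, Complex.norm_real, Complex.norm_real, norm_norm,
      Real.norm_of_nonneg hr0.le]
    field_simp
  have hzm : z ∈ disk := mem_disk.2 (hzn ▸ hr1)
  have h := hrel z hzm
  have hbb : conj b * b = (‖b‖ : ℂ) ^ 2 := Complex.conj_mul' b
  have h' : φ z * (η * ((1 + α * ‖b‖ * r : ℝ) : ℂ)) = η * b * (((r + ‖b‖) / ‖b‖ : ℝ) : ℂ) := by
    have hzb : conj b * z = r * ‖b‖ * η := by
      rw [hz]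
      field_simp
      linear_combination r * η * hbb
    have hz2 : z * ‖b‖ = r * η * b := by
      rw [hz]
      field_simp
    push_cast
    field_simp
    linear_combination hz2 - ‖b‖ * h - ‖b‖ * α * φ z * hzb
  have hn := congrArg norm h'
  have hpos : 0 < 1 + α * ‖b‖ * r := by positivity
  rw [norm_mul, norm_mul, norm_mul, norm_mul, hη, Complex.norm_real, Complex.norm_real,
    Real.norm_of_nonneg hpos.le, Real.norm_of_nonneg (by positivity)] at hn
  have hφ1 := mem_disk.1 (hφm hzm)
  have hn' : ‖φ z‖ * (1 + α * ‖b‖ * r) = r + ‖b‖ := by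
    rw [one_mul, one_mul] at hn
    rw [hn]
    field_simp
  nlinarith

section Dichotomy

variable {γ : ℕ → ℝ} {F φ : ℂ → ℂ}

lemma analyticOnNhd_conj_conj (hφ : AnalyticOnNhd ℂ φ disk) :
    AnalyticOnNhd ℂ (fun s => conj (φ (conj s))) disk := by
  refine DifferentiableOn.analyticOnNhd (fun s hs => ?_) Metric.isOpen_ball
  have h := (hφ _ (conj_mem_disk hs)).differentiableAt.hasDerivAt.conj_conj
  rw [Complex.conj_conj] at h
  exact h.differentiableAt.differentiableWithinAt

/-- The functional equation for the kernel leaves only rotations with constant weight, unless the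
kernel is a power of `1 / (1 - x)`, in which case `φ` is a Möbius map. -/
theorem rotation_or_mobius (hpos : ∀ n, 0 < γ n) (h0 : γ 0 = 1)
    (hs : ∀ x ∈ disk, Summable fun n => (γ n : ℂ) * x ^ n)
    (hF : AnalyticOnNhd ℂ F disk) (hφ : AnalyticOnNhd ℂ φ disk) (hφm : Set.MapsTo φ disk disk)
    (hid : ∀ w ∈ disk, ∀ z ∈ disk,
      F z * conj (F w) * kernelSeries γ (conj (φ w) * φ z) = kernelSeries γ (conj w * z)) :
    (IsRotation φ ∧ IsUnimodularConst F) ∨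
      ((∃ g : ℝ, 0 < g ∧ ∀ x ∈ disk, kernelSeries γ x = (1 - x) ^ (-(g : ℂ))) ∧
        ∃ η a : ℂ, ‖η‖ = 1 ∧ a ∈ disk ∧ ∀ z ∈ disk, φ z = η * mobius a z) := by
  have h0m := zero_mem_disk
  set k := kernelSeries γ with hkdef
  have hk : AnalyticOnNhd ℂ k disk := analyticOnNhd_kernelSeries hs
  have hcoef := iteratedDeriv_kernelSeries_zero hs
  have hk0 : k 0 = 1 := by simpa [h0] using hcoef 0
  have hk1 : deriv k 0 = γ 1 := by simpa using hcoef 1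
  have hk2 : deriv (deriv k) 0 = 2 * γ 2 := by
    simpa [iteratedDeriv_succ] using hcoef 2
  have hγ1 : (γ 1 : ℂ) ≠ 0 := by exact_mod_cast (hpos 1).ne'
  have hk1' : deriv k 0 ≠ 0 := by rwa [hk1]
  set f : ℂ → ℂ := fun s => conj (F (conj s)) with hfdef
  set ψ : ℂ → ℂ := fun s => conj (φ (conj s)) with hψdef
  have hf : AnalyticOnNhd ℂ f disk := analyticOnNhd_conj_conj hF
  have hψ : AnalyticOnNhd ℂ ψ disk := analyticOnNhd_conj_conj hφ
  have hψm : Set.MapsTo ψ disk disk := fun s hs => conj_mem_disk (hφm (conj_mem_disk hs))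
  have hid' : ∀ z ∈ disk, ∀ s ∈ disk, F z * f s * k (ψ s * φ z) = k (s * z) := by
    intro z hz s hs
    simpa using hid _ (conj_mem_disk hs) z hz
  set b := φ 0 with hb
  have hbm : b ∈ disk := hφm h0m
  have hψ0 : ψ 0 = conj b := by simp [hψdef, hb]
  set c := deriv φ 0 with hc
  have hφd : HasDerivAt φ c 0 := (hφ 0 h0m).differentiableAt.hasDerivAt
  have hψ1 : deriv ψ 0 = conj c := by
    have h := hφd.conj_conj
    rw [map_zero] at h
    exact h.deriv
  by_cases hb0 : b = 0
  · left
    have e0 : ∀ z ∈ disk, F z * f 0 = 1 := by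
      intro z hz
      simpa [hψ0, hb0, hk0] using hid' z hz 0 h0m
    have e1 : ∀ z ∈ disk, F z * (deriv f 0 + f 0 * (γ 1 * (conj c * φ z))) = γ 1 * z := by
      intro z hz
      simpa [hψ0, hb0, hk0, hk1, hψ1] using first_jet hk hf hψ hφm hψm hid' hz h0m
    have hf1 : deriv f 0 = 0 := by
      have h1 := e1 0 h0m
      have h2 := left_ne_zero_of_mul (by rw [e0 0 h0m]; exact one_ne_zero : F 0 * f 0 ≠ 0)
      rw [← hb, hb0] at h1
      simpa [h2] using h1
    have hlin : ∀ z ∈ disk, conj c * φ z = z := by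
      intro z hz
      have h1 := e1 z hz
      rw [hf1] at h1
      refine mul_left_cancel₀ hγ1 ?_
      linear_combination h1 - γ 1 * conj c * φ z * e0 z hz
    have hcc : conj c * c = 1 := by
      refine (hφd.const_mul (conj c)).unique ((hasDerivAt_id (0 : ℂ)).congr_of_eventuallyEq ?_)
      filter_upwards [disk_mem_nhds h0m] with z hz using hlin z hz
    refine ⟨⟨c, ?_, fun z hz => ?_⟩, F 0, ?_, fun z hz => ?_⟩
    · rw [Complex.conj_mul'] at hcc
      have : ‖c‖ ^ 2 = 1 := by exact_mod_cast hcc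
      exact (pow_eq_one_iff_of_nonneg (norm_nonneg c) two_ne_zero).1 this
    · linear_combination c * hlin z hz - φ z * hcc
    · have h1 := e0 0 h0m
      have h2 : f 0 = conj (F 0) := by simp [hfdef]
      rw [h2, Complex.mul_conj'] at h1
      have : ‖F 0‖ ^ 2 = 1 := by exact_mod_cast h1
      exact (pow_eq_one_iff_of_nonneg (norm_nonneg _) two_ne_zero).1 this
    · have h1 := e0 0 h0m
      refine mul_right_cancel₀ (right_ne_zero_of_mul (h1 ▸ one_ne_zero)) ((e0 z hz).trans h1.symm)
  right
  have hcc0 : conj c ≠ 0 := by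
    intro hcz
    -- If `φ'(0) = 0`, the first jet makes `z` constant.
    have key : ∀ z ∈ disk, γ 1 * z * f 0 = deriv f 0 := by
      intro z hz
      have h1 := first_jet hk hf hψ hφm hψm hid' hz h0m
      have h2 := hid' z hz 0 h0m
      rw [zero_mul, hk0] at h2
      rw [hψ1, hcz, zero_mul, zero_mul, hk1] at h1
      linear_combination deriv f 0 * h2 - f 0 * h1
    have h2 : (1 / 2 : ℂ) ∈ disk := by
      rw [mem_disk]
      norm_num
    have hf0 : f 0 ≠ 0 := by
      intro h
      simpa [h, hk0] using hid' 0 h0m 0 h0m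
    have h3 := (key _ h2).trans (key 0 h0m).symm
    simp [hγ1, hf0] at h3
  have hc0 : c ≠ 0 := by simpa using hcc0
  set α : ℝ := 2 * γ 2 / γ 1 - γ 1 with hα
  have hode : ∀ x ∈ disk, (1 - (α : ℂ) * x) * deriv k x = deriv k 0 * k x := by
    intro x hx
    have := exists_linear_ode hk hf hψ hφ hφm hψm hid' hk0 hk1' hc0 (by rwa [hψ1])
      (by rw [hψ0]; simpa using hb0) x hx
    rw [hk2, hk1] at this
    rw [hα, hk1]
    push_cast
    exact this
  have hrec : ∀ n : ℕ,
      ((n + 1).factorial : ℝ) * γ (n + 1) = (γ 1 + α * n) * (n.factorial * γ n) := by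
    intro n
    have := iteratedDeriv_succ_of_linear_ode hk hode n 0 h0m
    rw [hcoef, hcoef, hk1] at this
    simp only [mul_zero, sub_zero, one_mul] at this
    exact_mod_cast this
  have hα0 : 0 ≤ α := by
    -- Otherwise the factor `γ 1 + α n` is negative for large `n`.
    by_contra! hneg
    obtain ⟨n, hn⟩ := exists_nat_gt (γ 1 / -α)
    rw [div_lt_iff₀ (by linarith)] at hn
    have h1 := hrec n
    have h2 : 0 < ((n + 1).factorial : ℝ) * γ (n + 1) :=
      mul_pos (by exact_mod_cast (n + 1).factorial_pos) (hpos _)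
    have h3 : 0 < (n.factorial : ℝ) * γ n :=
      mul_pos (by exact_mod_cast n.factorial_pos) (hpos _)
    rw [h1] at h2
    have := (mul_pos_iff_of_pos_right h3).1 h2
    linarith
  have hα1 : α ≤ 1 := by
    -- Otherwise the equation forces `k` to vanish at `1 / α`, where it is at least `1`.
    by_contra! hgt
    have hlt : (1 / α : ℝ) < 1 := by
      rw [div_lt_one (by linarith)]
      exact hgt
    have hp : 0 ≤ (1 / α : ℝ) := by positivity
    have h1 := one_le_re_kernelSeries hpos h0 hs hp hlt
    have hm : ((1 / α : ℝ) : ℂ) ∈ disk := by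
      rw [mem_disk, Complex.norm_real, Real.norm_of_nonneg hp]
      exact hlt
    have h2 := hode _ hm
    have h3 : (1 - (α : ℂ) * ((1 / α : ℝ) : ℂ)) = 0 := by
      have : (α : ℂ) ≠ 0 := by exact_mod_cast (by linarith : α ≠ 0)
      push_cast
      field_simp
      ring
    rw [h3, zero_mul, hk1, zero_eq_mul] at h2
    have h4 := h2.resolve_left hγ1
    rw [← hkdef, h4] at h1
    norm_num at h1
  have hrel : ∀ z ∈ disk, z * (1 - α * (conj b * b)) * (1 - α * (conj b * φ z))
      = conj c * (φ z - b) := by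
    intro z hz
    have := mobius_relation hk hf hψ hφm hψm hid' hk0 hk1' hode hz
    rwa [hψ0, hψ1] at this
  set t : ℝ := 1 - α * ‖b‖ ^ 2 with ht
  have htb : (1 - α * (conj b * b) : ℂ) = t := by
    rw [Complex.conj_mul', ht]
    push_cast
    rfl
  have htpos : 0 < t := by
    have := one_sub_norm_sq_pos hbm
    have := sq_nonneg ‖b‖
    nlinarith
  have htc : (t : ℂ) ≠ 0 := by exact_mod_cast htpos.ne'
  -- Differentiating the Möbius relation at `0` gives `t² = |φ'(0)|²`.
  have hct : ‖c‖ = t := by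
    have h1 : HasDerivAt (fun z => z * t * (1 - α * (conj b * φ z)))
        (1 * t * (1 - α * (conj b * φ 0)) + 0 * t * (-(α * (conj b * c)))) 0 :=
      ((hasDerivAt_id (0 : ℂ)).mul_const (t : ℂ)).mul
        (((hφd.const_mul (conj b)).const_mul (α : ℂ)).const_sub 1)
    have h2 : HasDerivAt (fun z => conj c * (φ z - b)) (conj c * c) 0 :=
      (hφd.sub_const b).const_mul _
    have h3 := h1.unique (h2.congr_of_eventuallyEq (by
      filter_upwards [disk_mem_nhds h0m] with z hz
      rw [← hrel z hz, htb]))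
    rw [← hb, htb, Complex.conj_mul'] at h3
    have h4 : t ^ 2 = ‖c‖ ^ 2 := by
      have : ((t ^ 2 : ℝ) : ℂ) = ((‖c‖ ^ 2 : ℝ) : ℂ) := by
        push_cast
        linear_combination h3
      exact_mod_cast this
    exact ((sq_eq_sq₀ htpos.le (norm_nonneg _)).1 h4).symm
  set η : ℂ := conj c / t with hη
  have hηn : ‖η‖ = 1 := by
    rw [hη, norm_div, RCLike.norm_conj, hct, Complex.norm_real, Real.norm_of_nonneg htpos.le,
      div_self htpos.ne']
  have hrel' : ∀ z ∈ disk, z * (1 - α * (conj b * φ z)) = η * (φ z - b) := by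
    intro z hz
    have := hrel z hz
    rw [htb] at this
    rw [hη]
    field_simp
    linear_combination this
  have hαeq : α = 1 :=
    le_antisymm hα1 (one_le_of_mobius_relation hφm hηn hbm hb0 hα0 hrel')
  refine ⟨⟨γ 1, hpos 1, ?_⟩, η⁻¹, -(η * b), by simp [hηn], ?_, fun z hz => ?_⟩
  · refine eq_one_sub_cpow_of_linear_ode hk hk0 fun x hx => ?_
    have := hode x hx
    rwa [hαeq, hk1, Complex.ofReal_one, one_mul] at this
  · exact neg_mem_disk (rotation_mem_disk hηn hbm)
  · have h1 := hrel' z hz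
    have hη0 : η ≠ 0 := by
      intro h
      simp [h] at hηn
    have hηη : conj η * η = 1 := by
      rw [Complex.conj_mul', hηn]
      norm_num
    have hden := one_sub_conj_mul_ne_zero (neg_mem_disk (rotation_mem_disk hηn hbm)) hz
    rw [hαeq] at h1
    rw [mobius, ← mul_div_assoc, eq_div_iff hden, eq_inv_mul_iff_mul_eq₀ hη0]
    simp only [map_neg, map_mul]
    push_cast at h1
    linear_combination -h1 + conj b * z * φ z * hηη

end Dichotomy

/-! ### Branches of powers -/

/-- Two analytic logarithms of the same function on the disk differ by a period of `exp`. -/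
lemma exists_eq_add_of_exp_eq {L₁ L₂ : ℂ → ℂ} (h₁ : DifferentiableOn ℂ L₁ disk)
    (h₂ : DifferentiableOn ℂ L₂ disk) (h : ∀ z ∈ disk, exp (L₁ z) = exp (L₂ z)) :
    ∃ c : ℂ, exp c = 1 ∧ ∀ z ∈ disk, L₁ z = L₂ z + c := by
  obtain ⟨c, hc⟩ := Metric.isOpen_ball.exists_eq_add_of_deriv_eq isPreconnected_disk h₁ h₂ (by
    intro z hz
    have d₁ := (h₁.differentiableAt (disk_mem_nhds hz)).hasDerivAt.cexp
    have d₂ := (h₂.differentiableAt (disk_mem_nhds hz)).hasDerivAt.cexp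
    have := d₁.unique (d₂.congr_of_eventuallyEq (by
      filter_upwards [disk_mem_nhds hz] with w hw using h w hw))
    rw [h z hz] at this
    exact mul_left_cancel₀ (exp_ne_zero _) this)
  refine ⟨c, ?_, hc⟩
  have h0 := h 0 zero_mem_disk
  rw [hc zero_mem_disk, Complex.exp_add] at h0
  exact mul_left_cancel₀ (exp_ne_zero _) (h0.trans (mul_one _).symm)

lemma differentiableOn_log_one_sub {h : ℂ → ℂ} (hd : DifferentiableOn ℂ h disk)
    (hm : Set.MapsTo h disk disk) : DifferentiableOn ℂ (fun z => log (1 - h z)) disk :=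
  (hd.const_sub 1).clog fun _ hz => Or.inl (re_one_sub_pos (hm hz))

lemma differentiableOn_log_one_sub_mul {c : ℂ} (hc : c ∈ disk) :
    DifferentiableOn ℂ (fun z => log (1 - c * z)) disk :=
  differentiableOn_log_one_sub (differentiableOn_id.const_mul c) fun _ hz => mul_mem_disk hc hz

lemma one_sub_cpow_neg {x : ℂ} (hx : x ∈ disk) (g : ℂ) :
    (1 - x) ^ (-g) = exp (-g * log (1 - x)) := by
  rw [Complex.cpow_def_of_ne_zero (one_sub_ne_zero hx), mul_comm]

lemma mobius_self (a : ℂ) : mobius a a = 0 := by simp [mobius]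

/-- The power `-g` of `one_sub_conj_mobius_mul_mobius`, for principal branches: the logarithms of
both sides are analytic in `z` and agree at `z = a`. -/
lemma cpow_one_sub_conj_mobius_mul_mobius {a w z : ℂ} (ha : a ∈ disk) (hw : w ∈ disk)
    (hz : z ∈ disk) (g : ℂ) :
    (1 - conj a * z) ^ (-g) * (1 - conj w * a) ^ (-g)
        * (1 - conj (mobius a w) * mobius a z) ^ (-g)
      = (1 - conj a * a) ^ (-g) * (1 - conj w * z) ^ (-g) := by
  have ha' := conj_mem_disk ha
  have hw' := conj_mem_disk hw
  have hmw := conj_mem_disk (mapsTo_mobius ha hw)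
  obtain ⟨c, -, hc⟩ := exists_eq_add_of_exp_eq
    (L₁ := fun z => log (1 - conj (mobius a w) * mobius a z)
      + (log (1 - conj a * z) + log (1 - conj w * a)))
    (L₂ := fun z => log (1 - conj a * a) + log (1 - conj w * z))
    ((differentiableOn_log_one_sub ((differentiableOn_mobius ha).const_mul _)
      fun _ hz => mul_mem_disk hmw (mapsTo_mobius ha hz)).add
      ((differentiableOn_log_one_sub_mul ha').add_const _))
    ((differentiableOn_log_one_sub_mul hw').const_add _) (by
      intro z hz
      rw [Complex.exp_add, Complex.exp_add, Complex.exp_add,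
        Complex.exp_log (one_sub_ne_zero (mul_mem_disk hmw (mapsTo_mobius ha hz))),
        Complex.exp_log (one_sub_conj_mul_ne_zero ha hz),
        Complex.exp_log (one_sub_conj_mul_ne_zero hw ha),
        Complex.exp_log (one_sub_conj_mul_ne_zero ha ha),
        Complex.exp_log (one_sub_conj_mul_ne_zero hw hz)]
      exact one_sub_conj_mobius_mul_mobius ha hw hz)
  have hca := hc a ha
  have hcz := hc z hz
  simp only [mobius_self, mul_zero, sub_zero, Complex.log_one, zero_add] at hca
  rw [one_sub_cpow_neg (mul_mem_disk ha' hz), one_sub_cpow_neg (mul_mem_disk hw' ha),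
    one_sub_cpow_neg (mul_mem_disk hmw (mapsTo_mobius ha hz)),
    one_sub_cpow_neg (mul_mem_disk ha' ha), one_sub_cpow_neg (mul_mem_disk hw' hz),
    ← Complex.exp_add, ← Complex.exp_add, ← Complex.exp_add]
  congr 1
  linear_combination -g * hcz + g * hca

/-! ### Weighted composition operators -/

section Space

variable {H : Type*} [NormedAddCommGroup H] [InnerProductSpace ℂ H] [CompleteSpace H]
  [RKHS ℂ H disk ℂ] {γ : ℕ → ℝ} {F φ : ℂ → ℂ} {hmaps : Set.MapsTo φ disk disk} {T : H →L[ℂ] H}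

lemma HasKernelCoeffs.kern_apply (hγ : HasKernelCoeffs H γ) (w z : disk) :
    kern H w z = kernelSeries γ (conj (w : ℂ) * z) :=
  (hγ.2.2 w z).tsum_eq.symm

lemma HasKernelCoeffs.summable (hγ : HasKernelCoeffs H γ) {x : ℂ} (hx : x ∈ disk) :
    Summable fun n => (γ n : ℂ) * x ^ n := by
  have hx1 := mem_disk.1 hx
  have hn := norm_nonneg x
  -- Write `x = r (x / r)` with `|x| < r < 1`, so that both factors lie in the disk.
  set r : ℝ := (1 + ‖x‖) / 2 with hr
  have hr0 : 0 < r := by linarith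
  have hrm : (r : ℂ) ∈ disk := by
    rw [mem_disk, Complex.norm_real, Real.norm_of_nonneg hr0.le]
    linarith
  have hxm : x / r ∈ disk := by
    rw [mem_disk, norm_div, Complex.norm_real, Real.norm_of_nonneg hr0.le, div_lt_one hr0]
    linarith
  have hrc : (r : ℂ) ≠ 0 := by exact_mod_cast hr0.ne'
  have h := (hγ.2.2 ⟨r, hrm⟩ ⟨x / r, hxm⟩).summable
  simpa [Complex.conj_ofReal, mul_div_cancel₀ x hrc] using h

lemma HasKernelCoeffs.kern_of_eq_zero (hγ : HasKernelCoeffs H γ) {w : disk} (hw : (w : ℂ) = 0)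
    (z : disk) : kern H w z = 1 := by
  rw [hγ.kern_apply, hw, map_zero, zero_mul, kernelSeries, tsum_eq_single 0]
  · simp [hγ.2.1]
  · intro n hn
    simp [hn]

lemma kern_conj_symm (w z : disk) : conj (kern H w z) = kern H z w := by
  rw [← inner_kern z (kern H w), ← inner_kern w (kern H z), inner_conj_symm]

lemma norm_kern_sq (a : disk) : (‖kern H a‖ : ℂ) ^ 2 = kern H a a := by
  rw [← inner_kern, inner_self_eq_norm_sq_to_K]
  rfl

lemma HasKernelCoeffs.kern_ne_zero (hγ : HasKernelCoeffs H γ) (a : disk) : kern H a ≠ 0 := by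
  intro h
  have h1 := hγ.kern_of_eq_zero (w := ⟨0, zero_mem_disk⟩) rfl a
  rw [← kern_conj_symm, h] at h1
  simp at h1

lemma IsWCO.adjoint_kern (hT : IsWCO T F φ hmaps) (w : disk) :
    ContinuousLinearMap.adjoint T (kern H w) = conj (F w) • kern H ⟨φ w, hmaps w.2⟩ := by
  refine ext_inner_right ℂ fun v => ?_
  rw [ContinuousLinearMap.adjoint_inner_left, inner_kern, hT, inner_smul_left, inner_kern,
    Complex.conj_conj]

/-- Co-isometry of a weighted composition operator is a functional equation for the kernel. -/
lemma IsWCO.isCoisometric_iff (hT : IsWCO T F φ hmaps) :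
    IsCoisometric T ↔ ∀ w z : disk,
      F z * conj (F w) * kern H ⟨φ w, hmaps w.2⟩ ⟨φ z, hmaps z.2⟩ = kern H w z := by
  have key : ∀ w z : disk, T (ContinuousLinearMap.adjoint T (kern H w)) z
      = F z * conj (F w) * kern H ⟨φ w, hmaps w.2⟩ ⟨φ z, hmaps z.2⟩ := by
    intro w z
    rw [hT, hT.adjoint_kern, RKHS.coe_smul, Pi.smul_apply, smul_eq_mul, mul_assoc]
  constructor
  · intro h w z
    rw [← key]
    exact congrArg (fun f : H => f z) (DFunLike.congr_fun h (kern H w))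
  · intro h
    have hfix : ∀ w : disk, T (ContinuousLinearMap.adjoint T (kern H w)) = kern H w :=
      fun w => RKHS.ext fun z => by rw [key, h]
    refine ContinuousLinearMap.ext fun f => RKHS.ext fun z => ?_
    rw [ContinuousLinearMap.comp_apply, ContinuousLinearMap.id_apply, ← inner_kern z,
      ← ContinuousLinearMap.adjoint_inner_left, ContinuousLinearMap.adjoint_inner_right, hfix,
      inner_kern]

lemma IsWCO.rotation_or_mobius (hT : IsWCO T F φ hmaps) (hγ : HasKernelCoeffs H γ)
    (hF : AnalyticOnNhd ℂ F disk) (hφ : AnalyticOnNhd ℂ φ disk) (hco : IsCoisometric T) :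
    (IsRotation φ ∧ IsUnimodularConst F) ∨ ((∃ g : ℝ, IsConformalSpace H g) ∧
      ∃ η a : ℂ, ‖η‖ = 1 ∧ a ∈ disk ∧ ∀ z ∈ disk, φ z = η * mobius a z) := by
  have hid := hT.isCoisometric_iff.1 hco
  refine (WCO.rotation_or_mobius hγ.1 hγ.2.1 (fun x hx => hγ.summable hx) hF hφ hmaps ?_).imp_right
    (And.imp_left ?_)
  · intro w hw z hz
    simpa [hγ.kern_apply] using hid ⟨w, hw⟩ ⟨z, hz⟩
  · rintro ⟨g, hg, h⟩
    refine ⟨g, hg, fun w z => ?_⟩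
    rw [hγ.kern_apply, h _ (mul_mem_disk (conj_mem_disk w.2) z.2)]

lemma IsRotation.isDiskAutomorphism (hφ : AnalyticOnNhd ℂ φ disk) (h : IsRotation φ) :
    IsDiskAutomorphism φ := by
  obtain ⟨lam, hlam, h⟩ := h
  exact isDiskAutomorphism_of_eq_mobius hφ hlam zero_mem_disk fun z hz => by simp [h z hz, mobius]

lemma IsWCO.isDiskAutomorphism (hT : IsWCO T F φ hmaps) (hγ : HasKernelCoeffs H γ)
    (hF : AnalyticOnNhd ℂ F disk) (hφ : AnalyticOnNhd ℂ φ disk) (hco : IsCoisometric T) :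
    IsDiskAutomorphism φ := by
  obtain ⟨h, -⟩ | ⟨-, η, a, hη, ha, h⟩ := hT.rotation_or_mobius hγ hF hφ hco
  · exact h.isDiskAutomorphism hφ
  · exact isDiskAutomorphism_of_eq_mobius hφ hη ha h

/-- A co-isometric weighted composition operator is injective, since its weight has no zeros and its
symbol is onto; and a co-isometry `T` with `T f = 0` only for `f = 0` satisfies `T* T = I`, because
`T (T* T f - f) = 0`. -/
lemma IsWCO.mem_unitary_iff (hT : IsWCO T F φ hmaps) (hγ : HasKernelCoeffs H γ)
    (hF : AnalyticOnNhd ℂ F disk) (hφ : AnalyticOnNhd ℂ φ disk) :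
    T ∈ unitary (H →L[ℂ] H) ↔ IsCoisometric T := by
  refine ⟨fun h => (Unitary.mem_iff.1 h).2, fun hco => Unitary.mem_iff.2 ⟨?_, hco⟩⟩
  have hid := hT.isCoisometric_iff.1 hco
  have haut := hT.isDiskAutomorphism hγ hF hφ hco
  have hF0 : ∀ z : disk, F z ≠ 0 := by
    intro z hz
    have h := hid z z
    rw [hz, zero_mul, zero_mul, ← norm_kern_sq] at h
    exact pow_ne_zero 2 (by simpa using hγ.kern_ne_zero z) h.symm
  have hinj : ∀ f : H, T f = 0 → f = 0 := by
    intro f hf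
    refine RKHS.ext fun w => ?_
    obtain ⟨z, hz, hzw⟩ := haut.2.surjOn w.2
    have h := hT f ⟨z, hz⟩
    rw [hf] at h
    have hw : (⟨φ z, hmaps hz⟩ : disk) = w := Subtype.ext hzw
    rw [RKHS.coe_zero, Pi.zero_apply, hw, zero_eq_mul] at h
    simpa using h.resolve_left (hF0 ⟨z, hz⟩)
  refine ContinuousLinearMap.ext fun f => sub_eq_zero.1 (hinj _ ?_)
  rw [map_sub, sub_eq_zero]
  exact DFunLike.congr_fun hco (T f)

/-- If `φ` vanishes at some point `a`, the functional equation at `w = a` determines the weight. -/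
lemma IsWCO.isKernelWeight (hT : IsWCO T F φ hmaps) (hγ : HasKernelCoeffs H γ)
    (hco : IsCoisometric T) {a : ℂ} (ha : a ∈ disk) (hφa : φ a = 0) : IsKernelWeight H F φ := by
  have hid := hT.isCoisometric_iff.1 hco ⟨a, ha⟩
  set A : disk := ⟨a, ha⟩
  have hz : ∀ z : disk, F z * conj (F a) = kern H A z := by
    intro z
    have := hid z
    rwa [hγ.kern_of_eq_zero hφa, mul_one] at this
  have hn : (‖kern H A‖ : ℂ) ≠ 0 := by
    simpa using hγ.kern_ne_zero A
  have hsq : F a * conj (F a) = (‖kern H A‖ : ℂ) ^ 2 := by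
    rw [norm_kern_sq, ← hz A]
  refine ⟨A, F a / ‖kern H A‖, hφa, ?_, fun z => ?_⟩
  · have h1 : ‖F a‖ ^ 2 = ‖kern H A‖ ^ 2 := by
      rw [Complex.mul_conj'] at hsq
      exact_mod_cast hsq
    have h2 := (sq_eq_sq₀ (norm_nonneg _) (norm_nonneg _)).1 h1
    rw [norm_div, Complex.norm_real, norm_norm, h2, div_self]
    exact_mod_cast hn
  · rw [← hz z]
    field_simp
    linear_combination -F z * hsq

/-- On a conformal space the functional equation holds for an automorphism `φ` and its kernel weight:
it is `cpow_one_sub_conj_mobius_mul_mobius`. -/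
lemma IsKernelWeight.isCoisometric (hT : IsWCO T F φ hmaps) {g : ℝ} (hg : IsConformalSpace H g)
    (hγ : HasKernelCoeffs H γ) (haut : IsDiskAutomorphism φ) (hW : IsKernelWeight H F φ) :
    IsCoisometric T := by
  obtain ⟨A, ν, hA, hν, hFz⟩ := hW
  obtain ⟨η, a, hη, ha, hφ⟩ := haut.eq_mobius
  have hAa : (A : ℂ) = a := by
    refine haut.2.injOn A.2 ha ?_
    rw [hA, hφ a ha, mobius_self, mul_zero]
  have hηη : conj η * η = 1 := by
    rw [Complex.conj_mul', hη]
    norm_num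
  have hνν : ν * conj ν = 1 := by
    rw [Complex.mul_conj', hν]
    norm_num
  refine hT.isCoisometric_iff.2 fun w z => ?_
  have hn : (‖kern H A‖ : ℂ) ≠ 0 := by
    simpa using hγ.kern_ne_zero A
  have hcoc := cpow_one_sub_conj_mobius_mul_mobius (a := A) A.2 w.2 z.2 (g : ℂ)
  rw [← hg.2, ← hg.2, ← hg.2, ← hg.2, ← norm_kern_sq] at hcoc
  have hφφ : kern H ⟨φ w, hmaps w.2⟩ ⟨φ z, hmaps z.2⟩
      = (1 - conj (mobius A w) * mobius A z) ^ (-(g : ℂ)) := by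
    rw [hg.2, hAa]
    simp only [hφ _ w.2, hφ _ z.2, map_mul]
    congr 2
    linear_combination conj (mobius a w) * mobius a z * hηη
  rw [hφφ, hFz, hFz, map_mul, map_div₀, kern_conj_symm, Complex.conj_ofReal]
  field_simp
  linear_combination hcoc + kern H A z * kern H w A
    * (1 - conj (mobius A w) * mobius A z) ^ (-(g : ℂ)) * hνν

lemma norm_exp_mul_of_exp_eq_one {c : ℂ} (hc : exp c = 1) (s : ℝ) : ‖exp (s * c)‖ = 1 := by
  have h := congrArg norm hc
  rw [Complex.norm_exp, norm_one, Real.exp_eq_one_iff] at h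
  rw [Complex.norm_exp, Complex.re_ofReal_mul, h, mul_zero, Real.exp_zero]

/-- For `φ = η σ`, with `σ` the Möbius map of `a`, the function `(φ')^(g/2)` is a constant multiple
of `K_a`, and the modulus of the constant is `(1 - |a|²)^(g/2) = 1 / ‖K_a‖`. -/
lemma isDerivWeight_iff_isKernelWeight (hγ : HasKernelCoeffs H γ) {g : ℝ}
    (hg : IsConformalSpace H g) (haut : IsDiskAutomorphism φ) :
    IsDerivWeight F φ g ↔ IsKernelWeight H F φ := by
  obtain ⟨η, a, hη, ha, hφ⟩ := haut.eq_mobius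
  have hφa : φ a = 0 := by rw [hφ a ha, mobius_self, mul_zero]
  set A : disk := ⟨a, ha⟩ with hAdef
  have hη0 : η ≠ 0 := by
    rintro rfl
    simp at hη
  have hu0 : 0 < 1 - ‖a‖ ^ 2 := one_sub_norm_sq_pos ha
  set q : ℂ := η * (1 - conj a * a) with hq
  have hq0 : q ≠ 0 := mul_ne_zero hη0 (one_sub_conj_mul_ne_zero ha ha)
  have hqn : ‖q‖ = 1 - ‖a‖ ^ 2 := by
    rw [hq, one_sub_conj_mul_self_eq, norm_mul, hη, Complex.norm_real,
      Real.norm_of_nonneg hu0.le, one_mul]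
  have hn0 : 0 < ‖kern H A‖ := norm_pos_iff.2 (hγ.kern_ne_zero A)
  have hn : (‖kern H A‖ : ℂ) ≠ 0 := by exact_mod_cast hn0.ne'
  set M : ℂ := exp (((g / 2 : ℝ) : ℂ) * log q) with hM
  have hM0 : M ≠ 0 := exp_ne_zero _
  have hMK : ‖M‖ * ‖kern H A‖ = 1 := by
    have h1 : ‖M‖ ^ 2 = (1 - ‖a‖ ^ 2) ^ g := by
      rw [hM, Complex.norm_exp, Complex.re_ofReal_mul, Complex.log_re, hqn,
        Real.rpow_def_of_pos hu0, ← Real.exp_nat_mul]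
      congr 1
      push_cast
      ring
    have h2 : ‖kern H A‖ ^ 2 = (1 - ‖a‖ ^ 2) ^ (-g) := by
      have h := norm_kern_sq (H := H) A
      rw [hg.2, one_sub_conj_mul_self_eq, ← Complex.ofReal_neg,
        ← Complex.ofReal_cpow hu0.le] at h
      exact_mod_cast h
    have h3 : (‖M‖ * ‖kern H A‖) ^ 2 = 1 := by
      rw [mul_pow, h1, h2, ← Real.rpow_add hu0, add_neg_cancel, Real.rpow_zero]
    exact (pow_eq_one_iff_of_nonneg (by positivity) two_ne_zero).1 h3
  -- A logarithm of `φ'`; any other one differs from it by a period of `exp`.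
  set L₀ : ℂ → ℂ := fun z => log q - 2 * log (1 - conj a * z) with hL₀
  have hL₀d : DifferentiableOn ℂ L₀ disk :=
    ((differentiableOn_log_one_sub_mul (conj_mem_disk ha)).const_mul 2).const_sub _
  have hL₀e : ∀ z ∈ disk, exp (L₀ z) = deriv φ z := by
    intro z hz
    have h1 : HasDerivAt φ (η * ((1 - conj a * a) / (1 - conj a * z) ^ 2)) z :=
      ((hasDerivAt_mobius ha hz).const_mul η).congr_of_eventuallyEq (by
        filter_upwards [disk_mem_nhds hz] with y hy using hφ y hy)
    rw [h1.deriv, hL₀, Complex.exp_sub, Complex.exp_log hq0, two_mul, Complex.exp_add,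
      Complex.exp_log (one_sub_conj_mul_ne_zero ha hz), hq, ← sq, mul_div_assoc]
  have hpow : ∀ z : disk, exp (((g / 2 : ℝ) : ℂ) * L₀ z) = M * kern H A z := by
    intro z
    rw [hg.2, one_sub_cpow_neg (mul_mem_disk (conj_mem_disk ha) z.2), hM, ← Complex.exp_add]
    congr 1
    simp only [hL₀]
    push_cast
    ring
  constructor
  · rintro ⟨G, μ, ⟨L, hL, hLG⟩, hμ, hF⟩
    obtain ⟨c, hc, hLc⟩ := exists_eq_add_of_exp_eq hL.differentiableOn hL₀d fun z hz => by
      rw [(hLG z hz).1, hL₀e z hz]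
    refine ⟨A, μ * exp (((g / 2 : ℝ) : ℂ) * c) * (M * ‖kern H A‖), hφa, ?_, fun z => ?_⟩
    · rw [norm_mul, norm_mul, norm_mul, hμ, norm_exp_mul_of_exp_eq_one hc, Complex.norm_real,
        norm_norm, hMK]
      norm_num
    · rw [hF z z.2, (hLG z z.2).2, hLc z z.2, mul_add, Complex.exp_add, hpow z]
      field_simp
  · rintro ⟨B, ν, hB, hν, hF⟩
    have hBA : B = A := Subtype.ext (haut.2.injOn B.2 ha (hB.trans hφa.symm))
    subst hBA
    refine ⟨fun z => exp (((g / 2 : ℝ) : ℂ) * L₀ z), ν / (M * ‖kern H A‖),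
      ⟨L₀, hL₀d.analyticOnNhd Metric.isOpen_ball, fun z hz => ⟨hL₀e z hz, rfl⟩⟩, ?_, ?_⟩
    · rw [norm_div, norm_mul, Complex.norm_real, norm_norm, hMK, hν, div_one]
    · intro z hz
      have h1 := hF ⟨z, hz⟩
      have h2 := hpow ⟨z, hz⟩
      simp only at h1 h2 ⊢
      rw [h1, h2]
      field_simp

lemma isCoisometric_of_rotation (hT : IsWCO T F φ hmaps) (hγ : HasKernelCoeffs H γ)
    (hφ : IsRotation φ) (hF : IsUnimodularConst F) : IsCoisometric T := by
  obtain ⟨lam, hlam, hφ⟩ := hφ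
  obtain ⟨c, hc, hF⟩ := hF
  have h1 : conj lam * lam = 1 := by
    rw [Complex.conj_mul', hlam]
    norm_num
  have h2 : c * conj c = 1 := by
    rw [Complex.mul_conj', hc]
    norm_num
  refine hT.isCoisometric_iff.2 fun w z => ?_
  rw [hF z z.2, hF w w.2, h2, one_mul, hγ.kern_apply, hγ.kern_apply]
  simp only [hφ _ w.2, hφ _ z.2, map_mul]
  congr 1
  linear_combination conj (w : ℂ) * z * h1

end Space

end WCO

theorem theorem3p1 {H : Type*} [NormedAddCommGroup H] [InnerProductSpace ℂ H]
    [CompleteSpace H] [RKHS ℂ H WCO.disk ℂ] (hH : WCO.IsAnalyticSpace H)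
    (γ : ℕ → ℝ) (hγ : WCO.HasKernelCoeffs H γ)
    (F φ : ℂ → ℂ) (hF : AnalyticOnNhd ℂ F WCO.disk) (hφ : AnalyticOnNhd ℂ φ WCO.disk)
    (hmaps : Set.MapsTo φ WCO.disk WCO.disk)
    (T : H →L[ℂ] H) (hT : WCO.IsWCO T F φ hmaps) :
    (T ∈ unitary (H →L[ℂ] H) ↔ WCO.IsCoisometric T) ∧
    (∀ g : ℝ, WCO.IsConformalSpace H g →
      (WCO.IsCoisometric T ↔
        WCO.IsDiskAutomorphism φ ∧ WCO.IsDerivWeight F φ g ∧ WCO.IsKernelWeight H F φ) ∧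
      (WCO.IsDiskAutomorphism φ → (WCO.IsDerivWeight F φ g ↔ WCO.IsKernelWeight H F φ))) ∧
    ((¬ ∃ g : ℝ, WCO.IsConformalSpace H g) →
      (WCO.IsCoisometric T ↔ WCO.IsRotation φ ∧ WCO.IsUnimodularConst F)) := by
  refine ⟨hT.mem_unitary_iff hγ hF hφ, fun g hg => ⟨⟨fun hco => ?_, ?_⟩,
    WCO.isDerivWeight_iff_isKernelWeight hγ hg⟩, fun hne => ⟨fun hco => ?_, ?_⟩⟩
  · have haut := hT.isDiskAutomorphism hγ hF hφ hco
    obtain ⟨a, ha, hφa⟩ := haut.2.surjOn WCO.zero_mem_disk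
    have hW := hT.isKernelWeight hγ hco ha hφa
    exact ⟨haut, (WCO.isDerivWeight_iff_isKernelWeight hγ hg haut).2 hW, hW⟩
  · rintro ⟨haut, -, hW⟩
    exact hW.isCoisometric hT hg hγ haut
  · exact (hT.rotation_or_mobius hγ hF hφ hco).resolve_right fun h => hne h.1
  · rintro ⟨hrot, hconst⟩
    exact WCO.isCoisometric_of_rotation hT hγ hrot hconst
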